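/- Let $\mathbf{\Pi}$ be the homotopy category of pointed topological spaces having the pointed homotopy type of a finite (possibly empty) wedge of spheres of positive dimensions; its morphisms are the pointed homotopy classes of pointed maps. For an integer $n \ge 0$ let $\mathbf{\Pi}_{n+1}^{\infty}$ be the full subcategory of spaces with the homotopy type of a finite (possibly empty) wedge of spheres of dimension at least $n+1$, and let $I^n \colon \mathbf{\Pi}_{n+1}^{\infty} \to \mathbf{\Pi}$ be the inclusion. Write $\mathrm{Fun}^{\times}(\mathcal C^{\mathrm{op}}, \mathrm{Set})$ for the category of functors $\mathcal C^{\mathrm{op}} \to \mathrm{Set}$ that preserve finite products, and all natural transformations between them. The category of $\Pi$-algebras is $\mathrm{Fun}^{\times}(\mathbf{\Pi}^{\mathrm{op}}, \mathrm{Set})$. A $\Pi$-algebra $A$ is $n$-connected if $A(S^i)$ is a one-point set for all $1 \le i \le n$; let $\Pi\mathrm{Alg}_{n+1}^{\infty}$ be the full subcategory of $n$-connected $\Pi$-algebras. Choose for every object $X$ of $\mathbf{\Pi}$ a pointed homotopy equivalence $X \simeq \bigvee_{i} S^{n_i}$ with a finite wedge of spheres of positive dimensions. Set $\gamma(X) =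 \bigvee_{n_i > n} S^{n_i}$, and for a morphism $f \colon X \to Y$, with $Y \simeq \bigvee_j S^{m_j}$ the chosen equivalence, let $\gamma(f)$ be the class of the composite $$\bigvee_{n_i > n} S^{n_i} \hookrightarrow \bigvee_i S^{n_i} \simeq X \xrightarrow{f} Y \simeq \bigvee_j S^{m_j} \twoheadrightarrow \bigvee_{m_j > n} S^{m_j},$$ where the last map collapses the summands of dimension at most $n$. Then, for every such choice, $\gamma$ is a functor $\mathbf{\Pi} \to \mathbf{\Pi}_{n+1}^{\infty}$ (the collapse functor). Restriction along $\gamma$ and restriction along $I^n$ both send product-preserving functors to product-preserving functors, restriction along $\gamma$ takes values in $n$-connected $\Pi$-algebras, and the functors $$\gamma^* \colon \mathrm{Fun}^{\times}\big((\mathbf{\Pi}_{n+1}^{\infty})^{\mathrm{op}}, \mathrm{Set}\big) \rightleftarrows \Pi\mathrm{Alg}_{n+1}^{\infty} \colon (I^n)^*$$ form an equivalence of categories. -/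

import Mathlib

open CategoryTheory CategoryTheory.Limits

universe w

namespace PiAlgebra

/-! ### Pointed spaces and their homotopy category -/

/-- A pointed topological space. -/
structure PointedSpace : Type 1 where
  carrier : Type
  [top : TopologicalSpace carrier]
  pt : carrier

attribute [instance] PointedSpace.top

/-- A pointed map: a continuous map preserving the base points. -/
@[ext]
structure PointedMap (X Y : PointedSpace) : Type where
  toMap : C(X.carrier, Y.carrier)
  map_pt : toMap X.pt = Y.pt

instance : Category PointedSpace where
  Hom := PointedMap
  id X := ⟨ContinuousMap.id _, rfl⟩
  comp f g := ⟨g.toMap.comp f.toMap, by simp [f.map_pt, g.map_pt]⟩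

/-- Two pointed maps are related if they are homotopic through pointed maps, that is, homotopic
relative to the base point. -/
def pointedHomotopic : HomRel PointedSpace := fun X _ f g =>
  ContinuousMap.HomotopicRel (PointedMap.toMap f) (PointedMap.toMap g) {X.pt}

/-- Pointed homotopy is an equivalence relation compatible with composition. -/
instance : Congruence pointedHomotopic where
  equivalence :=
    ⟨fun f => ContinuousMap.HomotopicRel.refl (PointedMap.toMap f),
     fun h => ContinuousMap.HomotopicRel.symm h,
     fun h k => ContinuousMap.HomotopicRel.trans h k⟩
  comp_left := by
    intro X Y Z f g g' h
    obtain ⟨H⟩ := h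
    refine ⟨⟨(H.toHomotopy.compContinuousMap (PointedMap.toMap f)), ?_⟩⟩
    intro t x hx
    obtain rfl : x = X.pt := hx
    have hf : (PointedMap.toMap f) X.pt = Y.pt := f.map_pt
    have := H.prop t Y.pt rfl
    change H (t, (PointedMap.toMap f) X.pt) = (PointedMap.toMap g) ((PointedMap.toMap f) X.pt)
    rw [hf]
    exact this
  comp_right := by
    intro X Y Z f f' g h
    exact ContinuousMap.HomotopicRel.comp_continuousMap h (PointedMap.toMap g)

/-- The homotopy category of pointed spaces: pointed spaces and pointed homotopy classes of pointed
maps. Isomorphisms in it are the pointed homotopy equivalences. -/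
abbrev HoPointed : Type 1 := CategoryTheory.Quotient pointedHomotopic

/-- The functor sending a pointed map to its pointed homotopy class. -/
abbrev ho : PointedSpace ⥤ HoPointed := CategoryTheory.Quotient.functor pointedHomotopic

/-! ### Wedges of spheres -/

/-- The unit sphere `S^k` in `ℝ^(k+1)`, based at the first standard basis vector. -/
noncomputable def sphere (k : ℕ) : PointedSpace where
  carrier := Metric.sphere (0 : EuclideanSpace ℝ (Fin (k + 1))) 1
  pt := ⟨EuclideanSpace.single 0 1, by simp⟩

/-- The constant pointed map. -/
def constMap (X Y : PointedSpace) : X ⟶ Y where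
  toMap := ContinuousMap.const _ Y.pt
  map_pt := rfl

section Wedge

variable {ι : Type} (X : ι → PointedSpace)

/-- The relation on the disjoint union of a point and the spaces `X i` that glues all base points
to the extra point. -/
inductive WedgeRel : (Unit ⊕ Σ i, (X i).carrier) → (Unit ⊕ Σ i, (X i).carrier) → Prop
  | glue (i : ι) : WedgeRel (Sum.inl ()) (Sum.inr ⟨i, (X i).pt⟩)

/-- The wedge of a family of pointed spaces: their disjoint union with all base points identified
(and with the quotient topology). The wedge of the empty family is a point. -/
def wedge : PointedSpace where
  carrier := Quot (WedgeRel X)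
  pt := Quot.mk _ (Sum.inl ())

/-- The inclusion of a summand in a wedge. -/
def wedgeIncl (i : ι) : X i ⟶ wedge X where
  toMap := ⟨fun x => Quot.mk _ (Sum.inr ⟨i, x⟩),
    continuous_quot_mk.comp (continuous_inr.comp continuous_sigmaMk)⟩
  map_pt := (Quot.sound (WedgeRel.glue i)).symm

variable {X}

/-- The pointed map out of a wedge given by pointed maps out of the summands. -/
def wedgeDesc {Y : PointedSpace} (f : ∀ i, X i ⟶ Y) : wedge X ⟶ Y where
  toMap :=
    { toFun := Quot.lift (Sum.elim (fun _ => Y.pt) fun p => (PointedMap.toMap (f p.1)) p.2) (by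
        rintro _ _ ⟨i⟩
        exact (PointedMap.map_pt (f i)).symm)
      continuous_toFun := continuous_quot_lift _
        (continuous_const.sumElim
          (continuous_sigma fun i => (PointedMap.toMap (f i)).continuous)) }
  map_pt := rfl

end Wedge

/-- The wedge of spheres `⋁ i, S^(d i)`. -/
noncomputable def wedgeOfSpheres {ι : Type} (d : ι → ℕ) : PointedSpace :=
  wedge fun i => sphere (d i)

/-- An identification of `X`, up to pointed homotopy equivalence, with a finite (possibly empty)
wedge of spheres of dimensions greater than `n`. -/
structure SphereDecomposition (n : ℕ) (X : HoPointed) : Type 1 where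
  ι : Type
  finite : Finite ι
  dim : ι → ℕ
  lt_dim : ∀ i, n < dim i
  iso : X ≅ ho.obj (wedgeOfSpheres dim)

/-- `X` has the pointed homotopy type of a finite wedge of spheres of dimensions greater
than `n`. -/
def IsWedgeOfSpheres (n : ℕ) : ObjectProperty HoPointed := fun X =>
  Nonempty (SphereDecomposition n X)

theorem isWedgeOfSpheres_le (n : ℕ) : IsWedgeOfSpheres n ≤ IsWedgeOfSpheres 0 := by
  rintro X ⟨D⟩
  exact ⟨⟨D.ι, D.finite, D.dim, fun i => (Nat.zero_le n).trans_lt (D.lt_dim i), D.iso⟩⟩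

/-- `WedgeCat n` is the full subcategory of the homotopy category of pointed spaces on the spaces
with the homotopy type of a finite wedge of spheres of dimensions at least `n + 1`. In particular
`WedgeCat 0` is the category `Π`, where all positive dimensions are allowed. -/
abbrev WedgeCat (n : ℕ) : Type 1 := (IsWedgeOfSpheres n).FullSubcategory

/-- The inclusion functor `I^n`. -/
abbrev wedgeInclusion (n : ℕ) : WedgeCat n ⥤ WedgeCat 0 :=
  ObjectProperty.ιOfLE (isWedgeOfSpheres_le n)

/-- The sphere `S^i`, for `0 < i`, is the wedge of a one-element family. -/
noncomputable def sphereIso (i : ℕ) : sphere i ≅ wedgeOfSpheres fun _ : Unit => i where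
  hom := wedgeIncl (fun _ : Unit => sphere i) ()
  inv := wedgeDesc (X := fun _ : Unit => sphere i) fun _ => 𝟙 (sphere i)
  hom_inv_id := by
    apply PointedMap.ext
    rfl
  inv_hom_id := by
    apply PointedMap.ext
    apply ContinuousMap.ext
    rintro ⟨⟨⟩ | ⟨⟨⟩, x⟩⟩
    · exact (Quot.sound (WedgeRel.glue ())).symm
    · rfl

/-- The sphere `S^i`, `0 < i`, as an object of the category `Π`. -/
noncomputable def sphereObj (i : ℕ) (hi : 0 < i) : WedgeCat 0 where
  obj := ho.obj (sphere i)
  property := ⟨⟨Unit, inferInstance, fun _ => i, fun _ => hi, ho.mapIso (sphereIso i)⟩⟩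

/-! ### The collapse functor -/

section Collapse

/-- The inclusion `⋁_{n < d i} S^(d i) ⟶ ⋁ i, S^(d i)` of the summands of dimension greater
than `n`. -/
noncomputable def highInclusion (n : ℕ) {ι : Type} (d : ι → ℕ) :
    wedgeOfSpheres (fun i : {i : ι // n < d i} => d i) ⟶ wedgeOfSpheres d :=
  wedgeDesc (X := fun i : {i : ι // n < d i} => sphere (d i))
    fun i => wedgeIncl (fun j => sphere (d j)) i.1

/-- The map `⋁ i, S^(d i) ⟶ ⋁_{n < d i} S^(d i)` which collapses the summands of dimension at
most `n` to the base point and is the identity on the other ones. -/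
noncomputable def lowCollapse (n : ℕ) {ι : Type} (d : ι → ℕ) :
    wedgeOfSpheres d ⟶ wedgeOfSpheres (fun i : {i : ι // n < d i} => d i) :=
  wedgeDesc (X := fun i => sphere (d i)) fun i =>
    if h : n < d i then
      wedgeIncl (fun j : {i : ι // n < d i} => sphere (d j)) ⟨i, h⟩
    else constMap _ _

/-- A choice, for every object of `Π`, of an identification with a finite wedge of spheres. -/
abbrev DecompositionChoice : Type 1 := ∀ X : WedgeCat 0, SphereDecomposition 0 X.obj

variable (n : ℕ) (D : DecompositionChoice)

/-- The collapse functor on objects: `X ≃ ⋁ i, S^(d i)` is sent to `⋁_{n < d i} S^(d i)`. -/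
noncomputable def collapseObj (X : WedgeCat 0) : WedgeCat n where
  obj := ho.obj (wedgeOfSpheres fun i : {i : (D X).ι // n < (D X).dim i} => (D X).dim i)
  property :=
    ⟨{ ι := {i : (D X).ι // n < (D X).dim i}
       finite := have := (D X).finite; inferInstance
       dim := fun i => (D X).dim i
       lt_dim := fun i => i.2
       iso := Iso.refl _ }⟩

/-- The collapse functor on morphisms: `f` is sent to the composite
`⋁_{n < d i} S^(d i) ⟶ ⋁ i, S^(d i) ≃ X ⟶ Y ≃ ⋁ j, S^(e j) ⟶ ⋁_{n < e j} S^(e j)`. -/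
noncomputable def collapseMap {X Y : WedgeCat 0} (f : X ⟶ Y) :
    collapseObj n D X ⟶ collapseObj n D Y :=
  ObjectProperty.homMk
    (ho.map (highInclusion n (D X).dim) ≫ (D X).iso.inv ≫ f.hom ≫ (D Y).iso.hom ≫
      ho.map (lowCollapse n (D Y).dim))

/-- The collapse functor `γ`, once the assignment above is known to be functorial. -/
noncomputable def collapseFunctor
    (map_id : ∀ X : WedgeCat 0, collapseMap n D (𝟙 X) = 𝟙 (collapseObj n D X))
    (map_comp : ∀ {X Y Z : WedgeCat 0} (f : X ⟶ Y) (g : Y ⟶ Z),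
      collapseMap n D (f ≫ g) = collapseMap n D f ≫ collapseMap n D g) :
    WedgeCat 0 ⥤ WedgeCat n where
  obj := collapseObj n D
  map := collapseMap n D
  map_id := map_id
  map_comp := map_comp

end Collapse

/-! ### Product-preserving functors and `Π`-algebras -/

/-- The property of a functor `Cᵒᵖ ⥤ Set` of preserving finite products, i.e. of sending finite
coproducts in `C` (including the empty one) to products. -/
def preservesProducts (C : Type 1) [Category.{0} C] : ObjectProperty (Cᵒᵖ ⥤ Type w) := fun F =>
  PreservesFiniteProducts F

/-- The category `Fun^×(Cᵒᵖ, Set)` of product-preserving functors and natural transformations. -/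
abbrev ProdFun (C : Type 1) [Category.{0} C] : Type (w + 1) :=
  (preservesProducts.{w} C).FullSubcategory

/-- Restriction `G^* : Fun^×(Dᵒᵖ, Set) ⥤ Fun^×(Cᵒᵖ, Set)` along a functor `G : C ⥤ D` such that
composing with `Gᵒᵖ` preserves product-preserving functors. -/
abbrev restriction {C D : Type 1} [Category.{0} C] [Category.{0} D] (G : C ⥤ D)
    (hG : ∀ F : ProdFun.{w} D, PreservesFiniteProducts (G.op ⋙ F.obj)) :
    ProdFun.{w} D ⥤ ProdFun.{w} C :=
  (preservesProducts.{w} C).lift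
    ((preservesProducts.{w} D).ι ⋙ (Functor.whiskeringLeft Cᵒᵖ Dᵒᵖ (Type w)).obj G.op) hG

/-- The category of `Π`-algebras. -/
abbrev PiAlg : Type (w + 1) := ProdFun.{w} (WedgeCat 0)

/-- A `Π`-algebra `A` is `n`-connected if `A(S^i)` is a one-point set for all `1 ≤ i ≤ n`. -/
def IsConnected (n : ℕ) : ObjectProperty PiAlg.{w} := fun A =>
  ∀ (i : ℕ) (hi : 0 < i), i ≤ n → Nonempty (Unique (A.obj.obj (Opposite.op (sphereObj i hi))))

/-- The full subcategory of `n`-connected `Π`-algebras. -/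
abbrev ConnPiAlg (n : ℕ) : Type (w + 1) := (IsConnected.{w} n).FullSubcategory

end PiAlgebra

/-! Everything rests on one topological fact: a pointed map from `S^k` to a finite wedge of spheres
of dimensions greater than `k` is null-homotopic. Granting it, maps from `X` into a wedge of spheres
of dimensions above `n` do not see the low summands of `X`. Hence `γ` is a functor, left adjoint to
the full inclusion `I^n`, with the collapse `X ⟶ γ X` as unit (`collapseAdjunction`).

The rest is formal. Both functors preserve finite coproducts, so restriction along them preserves
product-preserving functors. The counit is invertible because `I^n` is fully faithful. A `Π`-algebra
`A` turns `X` into a product of values on spheres; if `A` is `n`-connected, the low factors are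
points, so `A` inverts the unit (`isIso_map_collapseUnit`). The images of counit and unit are
therefore the two natural isomorphisms of the equivalence.

For the fact itself, a map `S^k ⟶ S^m` with `k < m` is deformed off a point by `C^1` approximation
and Hausdorff dimension, then contracted in a stereographic chart. All homotopies are relative to
the whole preimage of the base point, not only to the base point: this lets homotopies of the
coordinates of a map into a wedge, seen inside the product, stay in the wedge. -/

namespace PiAlgebra

/-! ### Maps from a sphere to a sphere of larger dimension -/

section Smooth

open Metric Set Module Manifold ContDiff Topology

/-- Partition of unity: being `ε`-close to `f` is a convex condition on the value at each point,
solved locally by constants, and it is vacuous off `K`. -/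
theorem exists_contDiff_norm_sub_lt {E F : Type*} [NormedAddCommGroup E] [NormedSpace ℝ E]
    [FiniteDimensional ℝ E] [NormedAddCommGroup F] [NormedSpace ℝ F] {K : Set E}
    (hK : IsClosed K) (f : C(K, F)) {ε : ℝ} (hε : 0 < ε) :
    ∃ g : E → F, ContDiff ℝ 1 g ∧ ∀ x : K, ‖g x - f x‖ < ε := by
  let t : E → Set F := fun y => {c | ∀ hy : y ∈ K, c ∈ ball (f ⟨y, hy⟩) ε}
  have ht : ∀ y, Convex ℝ (t y) := by
    intro y
    simp only [t, ofPred_forall]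
    exact convex_iInter fun hy => convex_ball _ _
  have hloc : ∀ x : E, ∃ c : F, ∀ᶠ y in 𝓝 x, c ∈ t y := by
    intro x
    by_cases hx : x ∈ K
    · refine ⟨f ⟨x, hx⟩, ?_⟩
      have h1 : ∀ᶠ y : K in 𝓝 ⟨x, hx⟩, f ⟨x, hx⟩ ∈ ball (f y) ε := by
        have := f.continuous.continuousAt (x := ⟨x, hx⟩) (ball_mem_nhds _ hε)
        filter_upwards [this] with y hy
        exact mem_ball_comm.1 hy
      rw [nhds_subtype_eq_comap, Filter.eventually_comap] at h1
      filter_upwards [h1] with y hy hyK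
      exact hy ⟨y, hyK⟩ rfl
    · refine ⟨0, ?_⟩
      filter_upwards [hK.isOpen_compl.mem_nhds hx] with y hy hyK
      exact absurd hyK hy
  obtain ⟨g, hg⟩ := exists_contMDiffMap_forall_mem_convex_of_local_const (n := 1) 𝓘(ℝ, E) ht hloc
  exact ⟨g, g.contMDiff.contDiff, fun x => by simpa [dist_eq_norm] using hg x x.2⟩

/-- The image is the cone of positive multiples of `g x` for unit vectors `x`. The homogeneous
extension is `C^1` away from `0`, hence locally Lipschitz, so the Hausdorff dimension of the cone is
at most `finrank ℝ E`. -/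
theorem dense_compl_image_radial_extension {E F : Type*} [NormedAddCommGroup E]
    [InnerProductSpace ℝ E] [FiniteDimensional ℝ E] [NormedAddCommGroup F] [NormedSpace ℝ F]
    [FiniteDimensional ℝ F] (hEF : finrank ℝ E < finrank ℝ F) {g : E → F}
    (hg : ContDiff ℝ 1 g) : Dense ((fun v => ‖v‖ • g (‖v‖⁻¹ • v)) '' {0}ᶜ)ᶜ := by
  refine dense_compl_of_dimH_lt_finrank ?_
  calc dimH ((fun v => ‖v‖ • g (‖v‖⁻¹ • v)) '' {0}ᶜ) ≤ dimH ({0}ᶜ : Set E) := by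
        refine dimH_image_le_of_locally_lipschitzOn fun x hx => ?_
        have hn : ContDiffAt ℝ 1 (fun v : E => ‖v‖) x := contDiffAt_norm ℝ hx
        have : ContDiffAt ℝ 1 (fun v => ‖v‖ • g (‖v‖⁻¹ • v)) x :=
          hn.smul (hg.contDiffAt.comp x
            ((hn.inv (norm_ne_zero_iff.2 hx)).smul contDiffAt_id))
        obtain ⟨C, u, hu, h⟩ := this.exists_lipschitzOnWith
        exact ⟨C, u, mem_nhdsWithin_of_mem_nhds hu, h⟩
    _ ≤ dimH (univ : Set E) := dimH_mono (subset_univ _)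
    _ = finrank ℝ E := Real.dimH_univ_eq_finrank E
    _ < finrank ℝ F := by exact_mod_cast hEF

/-- Stereographic projection from `q` turns the contraction to `p` into a straight-line homotopy,
which fixes the points already at `p`. -/
theorem homotopicRel_const_of_forall_ne {X F : Type*} [TopologicalSpace X] [NormedAddCommGroup F]
    [InnerProductSpace ℝ F] (f : C(X, Metric.sphere (0 : F) 1)) (p q : Metric.sphere (0 : F) 1)
    (hp : p ≠ q) (hf : ∀ x, f x ≠ q) :
    f.HomotopicRel (ContinuousMap.const X p) (f ⁻¹' {p}) := by
  have hq : ‖(q : F)‖ = 1 := norm_eq_of_mem_sphere q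
  let φ := stereographic hq
  have hsrc : ∀ y, y ≠ q → y ∈ φ.source := fun y hy => by
    simpa [φ, stereographic_source] using hy
  have hφ : Continuous fun x => φ (f x) :=
    φ.continuousOn.comp_continuous f.continuous fun x => hsrc _ (hf x)
  have hsymm : Continuous φ.symm := continuousOn_univ.1 φ.continuousOn_symm
  refine ⟨⟨⟨⟨fun a => φ.symm (AffineMap.lineMap (φ (f a.2)) (φ p) (a.1 : ℝ)), ?_⟩, ?_, ?_⟩, ?_⟩⟩
  · refine hsymm.comp ?_
    simp only [AffineMap.lineMap_apply_module]
    have ht : Continuous fun a : unitInterval × X => (a.1 : ℝ) := by fun_prop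
    exact ((continuous_const.sub ht).smul (hφ.comp continuous_snd)).add
      (ht.smul continuous_const)
  · intro x
    simp [φ.left_inv (hsrc _ (hf x))]
  · intro x
    simp [φ.left_inv (hsrc _ hp)]
  · intro t x hx
    obtain hx : f x = p := hx
    simp [hx, φ.left_inv (hsrc _ hp)]

/-- Relative to the preimage of `p`, a map between spheres that raises the dimension is homotopic
to a map that is not surjective. -/
theorem exists_homotopicRel_forall_ne {E F : Type*} [NormedAddCommGroup E]
    [InnerProductSpace ℝ E] [FiniteDimensional ℝ E] [NormedAddCommGroup F] [InnerProductSpace ℝ F]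
    [FiniteDimensional ℝ F] (hEF : finrank ℝ E < finrank ℝ F)
    (f : C(Metric.sphere (0 : E) 1, Metric.sphere (0 : F) 1)) (p : Metric.sphere (0 : F) 1) :
    ∃ (g : C(Metric.sphere (0 : E) 1, Metric.sphere (0 : F) 1)) (q : Metric.sphere (0 : F) 1),
      p ≠ q ∧ (∀ x, g x ≠ q) ∧ f.HomotopicRel g (f ⁻¹' {p}) := by
  have hn : ∀ y : Metric.sphere (0 : F) 1, ‖(y : F)‖ = 1 := fun y => norm_eq_of_mem_sphere y
  obtain ⟨l, hl, hlf⟩ := exists_contDiff_norm_sub_lt isClosed_sphere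
    (⟨fun x => (f x : F), by fun_prop⟩ : C(Metric.sphere (0 : E) 1, F)) (ε := 1 / 10) (by norm_num)
  simp only [ContinuousMap.coe_mk] at hlf
  -- a direction close to `-p` that is not of the form `s • l x`
  obtain ⟨v, hv, hvp⟩ : ∃ v : F, v ∈ ((fun v => ‖v‖ • l (‖v‖⁻¹ • v)) '' {0}ᶜ)ᶜ ∧
      ‖v + p‖ < 1 / 10 := by
    have := (dense_compl_image_radial_extension hEF hl).exists_dist_lt (-(p : F))
      (ε := 1 / 10) (by norm_num)
    obtain ⟨v, hv, h⟩ := this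
    refine ⟨v, hv, ?_⟩
    rwa [dist_eq_norm, show -(p : F) - v = -(v + p) by abel, norm_neg] at h
  have hcone : ∀ (x : Metric.sphere (0 : E) 1) (s : ℝ), 0 < s → s • l x ≠ v := by
    intro x s hs h
    refine hv ⟨s • (x : E), ?_, ?_⟩
    · have : (x : E) ≠ 0 := by
        intro h0
        have := norm_eq_of_mem_sphere x
        simp [h0] at this
      simp [hs.ne', this]
    · have : ‖s • (x : E)‖ = s := by simp [norm_smul, abs_of_pos hs]
      simp only [this]
      rw [inv_smul_smul₀ hs.ne', h]
  have hvn : |‖v‖ - 1| < 1 / 10 := by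
    have := abs_norm_sub_norm_le v (-(p : F))
    rw [norm_neg, hn, sub_neg_eq_add] at this
    linarith
  rw [abs_lt] at hvn
  have hv0 : 0 < ‖v‖ := by linarith
  have hvin : inner ℝ v (p : F) < -(9 / 10) := by
    have h1 := real_inner_le_norm (v + p) (p : F)
    rw [inner_add_left, real_inner_self_eq_norm_sq, hn] at h1
    linarith
  obtain ⟨q, hqv, hq⟩ : ∃ q : Metric.sphere (0 : F) 1, (q : F) = ‖v‖⁻¹ • v ∧
      inner ℝ (q : F) (p : F) < -(7 / 10) := by
    refine ⟨⟨‖v‖⁻¹ • v, by simp [norm_smul, hv0.ne']⟩, rfl, ?_⟩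
    simp only [inner_smul_left, RCLike.conj_to_real]
    rw [inv_mul_lt_iff₀ hv0]
    linarith
  -- the cutoff function, `1` near `-p` and `0` near `p`
  let c : Metric.sphere (0 : E) 1 → ℝ := fun x => min 1 (max 0 (-2 * inner ℝ (f x : F) (p : F)))
  have hc : Continuous c := by fun_prop
  have hc0 : ∀ x, 0 ≤ c x := fun x => le_min zero_le_one (le_max_left _ _)
  have hc1 : ∀ x, c x ≤ 1 := fun x => min_le_left _ _
  let G : unitInterval × Metric.sphere (0 : E) 1 → F := fun a =>
    (f a.2 : F) + ((a.1 : ℝ) * c a.2) • (l a.2 - f a.2)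
  have hG : Continuous G := by
    have := hl.continuous
    fun_prop
  have hGf : ∀ a, ‖G a - f a.2‖ < 1 / 10 := by
    intro a
    simp only [G, add_sub_cancel_left, norm_smul]
    have h1 : ‖(a.1 : ℝ) * c a.2‖ ≤ 1 := by
      rw [Real.norm_of_nonneg (mul_nonneg a.1.2.1 (hc0 _))]
      exact mul_le_one₀ a.1.2.2 (hc0 _) (hc1 _)
    exact (mul_le_of_le_one_left (norm_nonneg _) h1).trans_lt (hlf a.2)
  have hGn : ∀ a, 9 / 10 < ‖G a‖ := by
    intro a
    have := norm_sub_norm_le (f a.2 : F) (G a)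
    rw [hn, norm_sub_rev] at this
    linarith [hGf a]
  have hG0 : ∀ a, 0 < ‖G a‖ := fun a => by linarith [hGn a]
  have hGc : Continuous fun a => ‖G a‖⁻¹ • G a := (hG.norm.inv₀ fun a => (hG0 a).ne').smul hG
  have hGm : ∀ a, ‖G a‖⁻¹ • G a ∈ Metric.sphere (0 : F) 1 := fun a => by
    simp [norm_smul, (hG0 a).ne']
  let H : C(unitInterval × Metric.sphere (0 : E) 1, Metric.sphere (0 : F) 1) :=
    ⟨fun a => ⟨‖G a‖⁻¹ • G a, hGm a⟩, hGc.subtype_mk hGm⟩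
  have hpq : p ≠ q := by
    rintro rfl
    have h1 := real_inner_self_eq_norm_sq (p : F)
    rw [hn p] at h1
    linarith
  let K : C(Metric.sphere (0 : E) 1, Metric.sphere (0 : F) 1) :=
    H.comp ((ContinuousMap.const _ 1).prodMk (ContinuousMap.id _))
  refine ⟨K, q, hpq, fun x h => ?_, ⟨⟨⟨H, fun x => ?_, fun x => rfl⟩, fun t x hx => ?_⟩⟩⟩
  · have h' : ‖G (1, x)‖⁻¹ • G (1, x) = ‖v‖⁻¹ • v :=
      (congrArg Subtype.val h).trans hqv
    -- Near `-p` the cutoff is `1`, so `G (1, x) = l x`, whose direction is not that of `v`.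
    -- Elsewhere `G (1, x)` has inner product with `p` above `-1/2 - 1/10 = -0.6`, whereas pointing
    -- along `q` would force it below `-(7/10) * (9/10) = -0.63`.
    rcases le_or_gt (inner ℝ (f x : F) (p : F)) (-(1 / 2)) with hx | hx
    · have hcx : c x = 1 := min_eq_left (le_max_of_le_right (by linarith))
      have hGl : G (1, x) = l x := by simp [G, hcx]
      refine hcone x (‖v‖ * ‖G (1, x)‖⁻¹) (mul_pos hv0 (inv_pos.2 (hG0 _))) ?_
      rw [← hGl, mul_smul, h', smul_inv_smul₀ hv0.ne']
    · have h1 : inner ℝ (‖G (1, x)‖⁻¹ • G (1, x)) (p : F) < -(7 / 10) := by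
        rwa [h', ← hqv]
      simp only [inner_smul_left, RCLike.conj_to_real] at h1
      rw [inv_mul_lt_iff₀ (hG0 _)] at h1
      have h2 := abs_real_inner_le_norm (G (1, x) - f x) (p : F)
      rw [inner_sub_left, hn, mul_one] at h2
      have h3 := hGf (1, x)
      have h4 := (abs_le.1 h2).1
      have h5 := hGn (1, x)
      simp only at h3
      linarith
  · refine Subtype.ext ?_
    simp [H, G]
  · obtain hx : f x = p := hx
    refine Subtype.ext ?_
    have hcx : c x = 0 := by
      simp [c, hx]
    simp [H, G, hcx]

theorem homotopicRel_const_of_finrank_lt {E F : Type*} [NormedAddCommGroup E]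
    [InnerProductSpace ℝ E] [FiniteDimensional ℝ E] [NormedAddCommGroup F] [InnerProductSpace ℝ F]
    [FiniteDimensional ℝ F] (hEF : finrank ℝ E < finrank ℝ F)
    (f : C(Metric.sphere (0 : E) 1, Metric.sphere (0 : F) 1)) (p : Metric.sphere (0 : F) 1) :
    f.HomotopicRel (ContinuousMap.const _ p) (f ⁻¹' {p}) := by
  obtain ⟨g, q, hpq, hg, hfg⟩ := exists_homotopicRel_forall_ne hEF f p
  -- The second homotopy is relative to `g ⁻¹' {p}`, which contains `f ⁻¹' {p}` because `f` and `g`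
  -- agree on the latter.
  refine hfg.trans ((homotopicRel_const_of_forall_ne g p q hpq hg).map fun K => ⟨K.1, ?_⟩)
  exact fun t x hx => K.2 t x ((hfg.fst_eq_snd hx).symm.trans hx)

end Smooth

/-! ### Wedges as coproducts in the homotopy category -/

section WedgeHomotopy

open Topology unitInterval

variable {ι : Type} {X : ι → PointedSpace}

theorem wedge_cases (w : (wedge X).carrier) :
    w = (wedge X).pt ∨ ∃ i x, w = PointedMap.toMap (wedgeIncl X i) x := by
  obtain ⟨⟨⟩ | ⟨i, x⟩⟩ := w
  · exact Or.inl rfl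
  · exact Or.inr ⟨i, x, rfl⟩

theorem wedgeIncl_desc {Y : PointedSpace} (f : ∀ i, X i ⟶ Y) (i : ι) :
    wedgeIncl X i ≫ wedgeDesc f = f i :=
  rfl

theorem wedgeIncl_desc_assoc {Y Z : PointedSpace} (f : ∀ i, X i ⟶ Y) (i : ι) (g : Y ⟶ Z) :
    wedgeIncl X i ≫ wedgeDesc f ≫ g = f i ≫ g :=
  rfl

theorem wedge_hom_ext {Y : PointedSpace} {f g : wedge X ⟶ Y}
    (h : ∀ i, wedgeIncl X i ≫ f = wedgeIncl X i ≫ g) : f = g := by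
  refine PointedMap.ext (ContinuousMap.ext fun w => ?_)
  rcases wedge_cases w with rfl | ⟨i, x, rfl⟩
  · exact (PointedMap.map_pt f).trans (PointedMap.map_pt g).symm
  · exact congrArg (fun k : X i ⟶ Y => PointedMap.toMap k x) (h i)

/-- The space of paths in `Y`, based at the constant path. -/
def pathSpace (Y : PointedSpace) : PointedSpace where
  carrier := C(I, Y.carrier)
  pt := ContinuousMap.const I Y.pt

/-- Evaluation of paths. -/
def pathEval (Y : PointedSpace) (t : I) : pathSpace Y ⟶ Y where
  toMap := ⟨fun p : C(I, Y.carrier) => p t, continuous_eval_const (F := C(I, Y.carrier)) t⟩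
  map_pt := rfl

/-- Currying makes a homotopy a single pointed map, so homotopies out of a wedge glue by its
universal property, with no need to describe the topology of the wedge times `I`. -/
theorem pointedHomotopic_iff_exists_pathSpace {A B : PointedSpace} (f g : A ⟶ B) :
    pointedHomotopic f g ↔
      ∃ H : A ⟶ pathSpace B, H ≫ pathEval B 0 = f ∧ H ≫ pathEval B 1 = g := by
  constructor
  · rintro ⟨H⟩
    refine ⟨⟨(H.toContinuousMap.comp ContinuousMap.prodSwap).curry, ?_⟩, ?_, ?_⟩
    · exact ContinuousMap.ext fun t => (H.eq_fst t rfl).trans (PointedMap.map_pt f)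
    · exact PointedMap.ext (ContinuousMap.ext fun x => by exact H.apply_zero x)
    · exact PointedMap.ext (ContinuousMap.ext fun x => by exact H.apply_one x)
  · rintro ⟨H, rfl, rfl⟩
    refine ⟨⟨⟨ContinuousMap.comp ⟨Function.uncurry fun x t => (show C(I, B.carrier) from PointedMap.toMap H x) t,
      ContinuousMap.continuous_uncurry_of_continuous (PointedMap.toMap H)⟩
        ContinuousMap.prodSwap, fun x => rfl, fun x => rfl⟩, ?_⟩⟩
    rintro t x rfl
    have h : PointedMap.toMap H A.pt = ContinuousMap.const I B.pt := PointedMap.map_pt H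
    change (show C(I, B.carrier) from PointedMap.toMap H A.pt) t =
      (show C(I, B.carrier) from PointedMap.toMap H A.pt) 0
    rw [h]
    rfl

theorem pointedHomotopic_of_wedgeIncl {Y : PointedSpace} {f g : wedge X ⟶ Y}
    (h : ∀ i, pointedHomotopic (wedgeIncl X i ≫ f) (wedgeIncl X i ≫ g)) :
    pointedHomotopic f g := by
  simp only [pointedHomotopic_iff_exists_pathSpace] at h ⊢
  choose H h0 h1 using h
  refine ⟨wedgeDesc H, wedge_hom_ext fun i => ?_, wedge_hom_ext fun i => ?_⟩
  · rw [wedgeIncl_desc_assoc, h0]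
  · rw [wedgeIncl_desc_assoc, h1]

theorem ho_wedge_hom_ext {Y : HoPointed} {f g : ho.obj (wedge X) ⟶ Y}
    (h : ∀ i, ho.map (wedgeIncl X i) ≫ f = ho.map (wedgeIncl X i) ≫ g) : f = g := by
  obtain ⟨Y⟩ := Y
  obtain ⟨f, rfl⟩ := ho.map_surjective (Y := Y) f
  obtain ⟨g, rfl⟩ := ho.map_surjective (Y := Y) g
  refine CategoryTheory.Quotient.sound _ (pointedHomotopic_of_wedgeIncl fun i => ?_)
  refine (CategoryTheory.Quotient.functor_map_eq_iff _ _ _).1 ?_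
  rw [Functor.map_comp, Functor.map_comp]
  exact h i

variable (X) in
/-- The wedge is a coproduct in the homotopy category. -/
noncomputable def hoWedgeIsColimit :
    IsColimit (Cofan.mk (f := fun i => ho.obj (X i)) (ho.obj (wedge X))
      fun i => ho.map (wedgeIncl X i)) :=
  Cofan.IsColimit.mk _
    (fun s => ho.map (Y := s.pt.as) (wedgeDesc fun i => ho.preimage (Y := s.pt.as) (s.inj i)))
    (fun s i => by
      change ho.map (wedgeIncl X i) ≫ ho.map (Y := s.pt.as) _ = _
      rw [← Functor.map_comp, wedgeIncl_desc]
      exact ho.map_preimage (Y := s.pt.as) _)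
    (fun s m hm => ho_wedge_hom_ext fun i => by
      refine (hm i).trans ?_
      rw [← Functor.map_comp, wedgeIncl_desc]
      exact (ho.map_preimage (Y := s.pt.as) _).symm)

instance (J : Type) : HasColimitsOfShape (Discrete J) HoPointed :=
  have (X : J → HoPointed) : HasCoproduct X :=
    ⟨⟨⟨_, hoWedgeIsColimit fun i => (X i).as⟩⟩⟩
  ⟨fun _ => hasColimit_of_iso Discrete.natIsoFunctor⟩

/-! ### Maps from a sphere to a wedge of spheres of larger dimensions -/

variable (X) in
/-- The product of a family of pointed spaces. -/
def piSpace : PointedSpace where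
  carrier := ∀ i, (X i).carrier
  pt := fun i => (X i).pt

open Classical in
variable (X) in
/-- The map from the wedge to the product. -/
noncomputable def wedgeToPi : wedge X ⟶ piSpace X :=
  wedgeDesc fun i =>
    { toMap := ⟨fun x => Function.update (piSpace X).pt i x,
        continuous_const.update i continuous_id⟩
      map_pt := Function.update_eq_self i _ }

theorem wedgeToPi_incl_self (i : ι) (x : (X i).carrier) :
    PointedMap.toMap (wedgeToPi X) (PointedMap.toMap (wedgeIncl X i) x) i = x :=
  by classical exact Function.update_self i x (piSpace X).pt

theorem wedgeToPi_incl_of_ne {i j : ι} (h : j ≠ i) (x : (X i).carrier) :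
    PointedMap.toMap (wedgeToPi X) (PointedMap.toMap (wedgeIncl X i) x) j = (X j).pt :=
  by classical exact Function.update_of_ne h x (piSpace X).pt

theorem wedgeToPi_pt (i : ι) :
    PointedMap.toMap (wedgeToPi X) (wedge X).pt i = (X i).pt :=
  congrFun (PointedMap.map_pt (wedgeToPi X)) i

theorem wedgeToPi_injective : Function.Injective (PointedMap.toMap (wedgeToPi X)) := by
  classical
  have key : ∀ i x w, PointedMap.toMap (wedgeToPi X) (PointedMap.toMap (wedgeIncl X i) x) =
      PointedMap.toMap (wedgeToPi X) w → PointedMap.toMap (wedgeIncl X i) x = w := by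
    intro i x w h
    rcases wedge_cases w with rfl | ⟨j, y, rfl⟩
    · have hx := congrFun h i
      rw [wedgeToPi_incl_self, wedgeToPi_pt] at hx
      rw [hx, PointedMap.map_pt]
    · have hi := congrFun h i
      have hj := congrFun h j
      rw [wedgeToPi_incl_self] at hi hj
      by_cases hij : i = j
      · subst hij
        rw [wedgeToPi_incl_self] at hi
        rw [hi]
      · rw [wedgeToPi_incl_of_ne hij] at hi
        rw [wedgeToPi_incl_of_ne (Ne.symm hij)] at hj
        rw [hi, ← hj, PointedMap.map_pt, PointedMap.map_pt]
  intro v w h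
  rcases wedge_cases v with rfl | ⟨i, x, rfl⟩
  · rcases wedge_cases w with rfl | ⟨j, y, rfl⟩
    · rfl
    · exact (key _ _ _ h.symm).symm
  · exact key _ _ _ h

/-- By compactness the wedge is a closed subspace of the product: the points with at most one
coordinate off its base point. Contract all coordinates of `f` at once; a coordinate at its base
point never moves, so the homotopy stays in the wedge, and the embedding gives its continuity there.
-/
theorem pointedHomotopic_constMap_of_forall [Finite ι] [∀ i, CompactSpace (X i).carrier]
    [∀ i, T2Space (X i).carrier] {Z : PointedSpace}
    (hX : ∀ i (f : C(Z.carrier, (X i).carrier)),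
      f.HomotopicRel (ContinuousMap.const _ (X i).pt) (f ⁻¹' {(X i).pt}))
    (f : Z ⟶ wedge X) : pointedHomotopic f (constMap Z (wedge X)) := by
  classical
  have : CompactSpace (wedge X).carrier := Quot.compactSpace
  have : T2Space (piSpace X).carrier := inferInstanceAs (T2Space (∀ i, (X i).carrier))
  have hemb : IsClosedEmbedding (PointedMap.toMap (wedgeToPi X)) :=
    (PointedMap.toMap (wedgeToPi X)).continuous.isClosedEmbedding wedgeToPi_injective
  let g : ∀ i, C(Z.carrier, (X i).carrier) := fun i =>
    ⟨fun z => PointedMap.toMap (wedgeToPi X) (PointedMap.toMap f z) i,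
      (continuous_apply i).comp ((PointedMap.toMap (wedgeToPi X)).continuous.comp
        (PointedMap.toMap f).continuous)⟩
  let H : ∀ i, (g i).HomotopyRel (ContinuousMap.const _ (X i).pt) (g i ⁻¹' {(X i).pt}) :=
    fun i => (hX i (g i)).some
  have hH : ∀ i a, g i a.2 = (X i).pt → H i a = (X i).pt := fun i a h =>
    ((H i).eq_fst a.1 h).trans h
  have hmem : ∀ a : I × Z.carrier, ∃ w, PointedMap.toMap (wedgeToPi X) w = fun i => H i a := by
    intro a
    rcases wedge_cases (PointedMap.toMap f a.2) with h | ⟨j, x, h⟩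
    · refine ⟨(wedge X).pt, funext fun i => (wedgeToPi_pt i).trans (hH i a ?_).symm⟩
      change PointedMap.toMap (wedgeToPi X) (PointedMap.toMap f a.2) i = _
      rw [h, wedgeToPi_pt]
    · refine ⟨PointedMap.toMap (wedgeIncl X j) (H j a), funext fun i => ?_⟩
      by_cases hij : i = j
      · subst hij
        rw [wedgeToPi_incl_self]
      · rw [wedgeToPi_incl_of_ne hij]
        refine (hH i a ?_).symm
        change PointedMap.toMap (wedgeToPi X) (PointedMap.toMap f a.2) i = _
        rw [h, wedgeToPi_incl_of_ne hij]
  choose L hL using hmem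
  have hLc : Continuous L := by
    rw [hemb.isInducing.continuous_iff]
    have : (PointedMap.toMap (wedgeToPi X)) ∘ L = fun a i => H i a := funext hL
    rw [this]
    exact continuous_pi fun i => (H i).continuous
  refine ⟨⟨⟨⟨L, hLc⟩, fun z => wedgeToPi_injective ?_, fun z => wedgeToPi_injective ?_⟩, ?_⟩⟩
  · exact (hL _).trans (funext fun i => (H i).apply_zero z)
  · exact (hL _).trans ((funext fun i => (H i).apply_one z).trans
      (PointedMap.map_pt (wedgeToPi X)).symm)
  · rintro t z rfl
    refine wedgeToPi_injective ((hL _).trans (funext fun i => ?_))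
    refine (H i).eq_fst t ?_
    change PointedMap.toMap (wedgeToPi X) (PointedMap.toMap f Z.pt) i = _
    rw [PointedMap.map_pt, wedgeToPi_pt]

instance (k : ℕ) : CompactSpace (sphere k).carrier :=
  inferInstanceAs (CompactSpace (Metric.sphere (0 : EuclideanSpace ℝ (Fin (k + 1))) 1))

instance (k : ℕ) : T2Space (sphere k).carrier :=
  inferInstanceAs (T2Space (Metric.sphere (0 : EuclideanSpace ℝ (Fin (k + 1))) 1))

theorem pointedHomotopic_constMap_of_lt_dim [Finite ι] {k : ℕ} {d : ι → ℕ} (hd : ∀ i, k < d i)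
    (f : sphere k ⟶ wedgeOfSpheres d) : pointedHomotopic f (constMap _ _) :=
  pointedHomotopic_constMap_of_forall (Z := sphere k) (X := fun i => sphere (d i))
    (fun i g => homotopicRel_const_of_finrank_lt (by simpa using hd i) g _) f

/-- The only topological input to the categorical part: every such map is the class of the constant
map. -/
theorem sphere_hom_eq {n k : ℕ} (hk : k ≤ n) {Y : HoPointed} (hY : IsWedgeOfSpheres n Y)
    (f g : ho.obj (sphere k) ⟶ Y) : f = g := by
  obtain ⟨⟨J, _, d, hd, e⟩⟩ := hY
  rw [← cancel_mono e.hom]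
  have key : ∀ h : ho.obj (sphere k) ⟶ ho.obj (wedgeOfSpheres d), h = ho.map (constMap _ _) := by
    intro h
    obtain ⟨h, rfl⟩ := ho.map_surjective h
    exact CategoryTheory.Quotient.sound _ (pointedHomotopic_constMap_of_lt_dim (fun i => hk.trans_lt (hd i)) h)
  rw [key (f ≫ e.hom), key (g ≫ e.hom)]

end WedgeHomotopy

/-! ### Finite coproducts of wedges of spheres -/

section Coproducts

variable (n : ℕ)

instance : (IsWedgeOfSpheres n).IsClosedUnderIsomorphisms where
  of_iso e := fun ⟨D⟩ => ⟨{ D with iso := e.symm ≪≫ D.iso }⟩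

/-- A wedge of wedges is the wedge over the sigma type. Finite coproducts in `WedgeCat n` are thus
computed in `HoPointed`, for every `n`. -/
instance (J : Type) [Finite J] :
    (IsWedgeOfSpheres n).IsClosedUnderColimitsOfShape (Discrete J) := by
  refine .mk' ?_
  rintro _ ⟨F, hF⟩
  let D : ∀ j : J, SphereDecomposition n (F.obj ⟨j⟩) := fun j => (hF ⟨j⟩).some
  have := fun j => (D j).finite
  let e₁ : colimit F ≅ ∐ fun j => ho.obj (wedgeOfSpheres (D j).dim) :=
    HasColimit.isoOfNatIso (Discrete.natIso fun j => (D j.as).iso)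
  let e₂ : (∐ fun j => ho.obj (wedgeOfSpheres (D j).dim)) ≅
      ho.obj (wedgeOfSpheres fun a : Σ j, (D j).ι => (D a.1).dim a.2) :=
    (Cofan.isColimitTrans _ (coproductIsCoproduct fun j => ho.obj (wedgeOfSpheres (D j).dim)) _
      fun j => hoWedgeIsColimit fun i => sphere ((D j).dim i)).coconePointUniqueUpToIso
        (hoWedgeIsColimit fun a : Σ j, (D j).ι => sphere ((D a.1).dim a.2))
  exact ⟨{
    ι := Σ j, (D j).ι
    finite := inferInstance
    dim := fun a => (D a.1).dim a.2
    lt_dim := fun a => (D a.1).lt_dim a.2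
    iso := e₁ ≪≫ e₂ }⟩

instance (J : Type) [Finite J] :
    PreservesColimitsOfShape (Discrete J) (wedgeInclusion n) :=
  have : PreservesColimitsOfShape (Discrete J) (wedgeInclusion n ⋙ (IsWedgeOfSpheres 0).ι) :=
    inferInstanceAs (PreservesColimitsOfShape (Discrete J) (IsWedgeOfSpheres n).ι)
  preservesColimitsOfShape_of_reflects_of_preserves _ (IsWedgeOfSpheres 0).ι

instance : PreservesFiniteCoproducts (wedgeInclusion n) where
  preserves _ := inferInstance

end Coproducts

/-! ### The collapse functor as a left adjoint -/

section Collapse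

variable (n : ℕ)

/-- The inclusion of a sphere in a wedge of spheres. -/
noncomputable abbrev sphereIncl {ι : Type} (d : ι → ℕ) (i : ι) :
    ho.obj (sphere (d i)) ⟶ ho.obj (wedgeOfSpheres d) :=
  ho.map (wedgeIncl (fun i => sphere (d i)) i)

theorem wedgeOfSpheres_hom_ext {ι : Type} {d : ι → ℕ} {Y : HoPointed}
    {f g : ho.obj (wedgeOfSpheres d) ⟶ Y} (h : ∀ i, sphereIncl d i ≫ f = sphereIncl d i ≫ g) :
    f = g :=
  ho_wedge_hom_ext h

variable {ι : Type} (d : ι → ℕ)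

theorem highInclusion_comp_lowCollapse : highInclusion n d ≫ lowCollapse n d = 𝟙 _ := by
  refine wedge_hom_ext (X := fun i : {i : ι // n < d i} => sphere (d i)) fun i => ?_
  have h : wedgeIncl (fun i => sphere (d i)) i.1 ≫ lowCollapse n d =
      wedgeIncl (fun i : {i : ι // n < d i} => sphere (d i)) i :=
    (wedgeIncl_desc (X := fun i => sphere (d i)) _ i.1).trans (dif_pos i.2)
  exact h

theorem sphereIncl_lowCollapse_highInclusion {i : ι} (hi : n < d i) :
    sphereIncl d i ≫ ho.map (lowCollapse n d) ≫ ho.map (highInclusion n d) = sphereIncl d i := by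
  have h : wedgeIncl (fun i => sphere (d i)) i ≫ lowCollapse n d =
      wedgeIncl (fun i : {i : ι // n < d i} => sphere (d i)) ⟨i, hi⟩ :=
    (wedgeIncl_desc (X := fun i => sphere (d i)) _ i).trans (dif_pos hi)
  exact congrArg (fun k => ho.map (k ≫ highInclusion n d)) h

theorem ho_highInclusion_comp_lowCollapse :
    ho.map (highInclusion n d) ≫ ho.map (lowCollapse n d) = 𝟙 _ := by
  rw [← Functor.map_comp, highInclusion_comp_lowCollapse, CategoryTheory.Functor.map_id]

theorem ho_highInclusion_comp_lowCollapse_assoc {Y : HoPointed}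
    (g : ho.obj (wedgeOfSpheres fun i : {i : ι // n < d i} => d i) ⟶ Y) :
    ho.map (highInclusion n d) ≫ ho.map (lowCollapse n d) ≫ g = g := by
  rw [← Category.assoc, ho_highInclusion_comp_lowCollapse, Category.id_comp]

/-- Maps to a wedge of spheres of dimensions greater than `n` do not see the spheres of dimension
at most `n`. -/
theorem lowCollapse_highInclusion_comp {Y : HoPointed} (hY : IsWedgeOfSpheres n Y)
    (g : ho.obj (wedgeOfSpheres d) ⟶ Y) :
    ho.map (lowCollapse n d) ≫ ho.map (highInclusion n d) ≫ g = g := by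
  refine wedgeOfSpheres_hom_ext fun i => ?_
  by_cases hi : n < d i
  · simpa only [Category.assoc] using
      congrArg (· ≫ g) (sphereIncl_lowCollapse_highInclusion n d hi)
  · exact sphere_hom_eq (not_lt.1 hi) hY _ _

variable (D : DecompositionChoice)

theorem collapseMap_id (X : WedgeCat 0) : collapseMap n D (𝟙 X) = 𝟙 (collapseObj n D X) := by
  apply ObjectProperty.hom_ext
  simp [collapseMap, ho_highInclusion_comp_lowCollapse, collapseObj]

theorem isWedgeOfSpheres_collapse (X : WedgeCat 0) : IsWedgeOfSpheres n
    (ho.obj (wedgeOfSpheres fun i : {i : (D X).ι // n < (D X).dim i} => (D X).dim i)) :=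
  (collapseObj n D X).property

/-- The two sides differ by collapsing and reincluding in the middle of `Y`; this idempotent is
absorbed because the final target is a wedge of high spheres. -/
theorem collapseMap_comp {X Y Z : WedgeCat 0} (f : X ⟶ Y) (g : Y ⟶ Z) :
    collapseMap n D (f ≫ g) = collapseMap n D f ≫ collapseMap n D g := by
  apply ObjectProperty.hom_ext
  have := lowCollapse_highInclusion_comp n (D Y).dim (isWedgeOfSpheres_collapse n D Z)
    ((D Y).iso.inv ≫ g.hom ≫ (D Z).iso.hom ≫ ho.map (lowCollapse n (D Z).dim))
  change ho.map (highInclusion n (D X).dim) ≫ (D X).iso.inv ≫ (f.hom ≫ g.hom) ≫ (D Z).iso.hom ≫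
      ho.map (lowCollapse n (D Z).dim) =
    (ho.map (highInclusion n (D X).dim) ≫ (D X).iso.inv ≫ f.hom ≫ (D Y).iso.hom ≫
      ho.map (lowCollapse n (D Y).dim)) ≫ ho.map (highInclusion n (D Y).dim) ≫ (D Y).iso.inv ≫
        g.hom ≫ (D Z).iso.hom ≫ ho.map (lowCollapse n (D Z).dim)
  simp only [Category.assoc, this, Iso.hom_inv_id_assoc]

/-- The collapse functor `γ`. -/
noncomputable abbrev collapse : WedgeCat 0 ⥤ WedgeCat n :=
  collapseFunctor n D (collapseMap_id n D) (collapseMap_comp n D)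

/-- The collapse map `X ⟶ γ X`. -/
noncomputable def collapseUnit (X : WedgeCat 0) :
    X ⟶ (wedgeInclusion n).obj ((collapse n D).obj X) :=
  ObjectProperty.homMk ((D X).iso.hom ≫ ho.map (lowCollapse n (D X).dim))

/-- The inclusion `γ Z ⟶ Z` for a wedge `Z` of spheres of dimensions greater than `n`. -/
noncomputable def collapseCounit (Z : WedgeCat n) :
    (collapse n D).obj ((wedgeInclusion n).obj Z) ⟶ Z :=
  ObjectProperty.homMk (ho.map (highInclusion n (D ((wedgeInclusion n).obj Z)).dim) ≫
    (D ((wedgeInclusion n).obj Z)).iso.inv)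

theorem collapseUnit_comp_inclusion_map {X : WedgeCat 0} {Z : WedgeCat n}
    (g : X ⟶ (wedgeInclusion n).obj Z) :
    collapseUnit n D X ≫ (wedgeInclusion n).map
      ((collapse n D).map g ≫ collapseCounit n D Z) = g := by
  apply ObjectProperty.hom_ext
  let W := D ((wedgeInclusion n).obj Z)
  change ((D X).iso.hom ≫ ho.map (lowCollapse n (D X).dim)) ≫
    (ho.map (highInclusion n (D X).dim) ≫ (D X).iso.inv ≫ g.hom ≫ W.iso.hom ≫
      ho.map (lowCollapse n W.dim)) ≫ ho.map (highInclusion n W.dim) ≫ W.iso.inv = g.hom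
  -- The chosen decomposition `W` of `Z` is only known to have positive dimensions. Applying the
  -- absorption to `W.iso.inv` avoids showing that they all exceed `n`.
  have h₁ := lowCollapse_highInclusion_comp n W.dim Z.property W.iso.inv
  have h₂ := lowCollapse_highInclusion_comp n (D X).dim Z.property ((D X).iso.inv ≫ g.hom)
  simp only [Category.assoc, h₁]
  erw [W.iso.hom_inv_id, Category.comp_id, h₂, Iso.hom_inv_id_assoc]

theorem inclusion_map_comp_collapse {X : WedgeCat 0} {Z : WedgeCat n}
    (h : (collapse n D).obj X ⟶ Z) :
    (collapse n D).map (collapseUnit n D X ≫ (wedgeInclusion n).map h) ≫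
      collapseCounit n D Z = h := by
  apply ObjectProperty.hom_ext
  let W := D ((wedgeInclusion n).obj Z)
  let k : ho.obj (wedgeOfSpheres fun i : {i // n < (D X).dim i} => (D X).dim i) ⟶ Z.obj := h.hom
  change (ho.map (highInclusion n (D X).dim) ≫ (D X).iso.inv ≫
    (((D X).iso.hom ≫ ho.map (lowCollapse n (D X).dim)) ≫ k) ≫ W.iso.hom ≫
      ho.map (lowCollapse n W.dim)) ≫ ho.map (highInclusion n W.dim) ≫ W.iso.inv = k
  have h₁ := lowCollapse_highInclusion_comp n W.dim Z.property W.iso.inv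
  simp only [Category.assoc, h₁, Iso.inv_hom_id_assoc, ho_highInclusion_comp_lowCollapse_assoc]
  erw [W.iso.hom_inv_id, Category.comp_id]

/-- The collapse functor is left adjoint to the inclusion, with the collapse maps as unit. -/
noncomputable def collapseAdjunction : collapse n D ⊣ wedgeInclusion n :=
  Adjunction.mkOfHomEquiv
    { homEquiv := fun X Z =>
        { toFun := fun h => collapseUnit n D X ≫ (wedgeInclusion n).map h
          invFun := fun g => (collapse n D).map g ≫ collapseCounit n D Z
          left_inv := inclusion_map_comp_collapse n D
          right_inv := collapseUnit_comp_inclusion_map n D }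
      homEquiv_naturality_left_symm := fun f g => by
        simp
      homEquiv_naturality_right := fun f g => by
        change collapseUnit n D _ ≫ (wedgeInclusion n).map (f ≫ g) =
          (collapseUnit n D _ ≫ (wedgeInclusion n).map f) ≫ (wedgeInclusion n).map g
        rw [Functor.map_comp, Category.assoc] }

theorem collapseAdjunction_unit_app (X : WedgeCat 0) :
    (collapseAdjunction n D).unit.app X = collapseUnit n D X :=
  (congrArg (collapseUnit n D X ≫ ·) ((wedgeInclusion n).map_id _)).trans (Category.comp_id _)

end Collapse

/-! ### Restriction along the collapse functor and along the inclusion -/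

section Restriction

variable (n : ℕ) (D : DecompositionChoice)

/-- A left adjoint preserves all colimits that exist. -/
instance : PreservesFiniteCoproducts (collapse n D) :=
  have := (collapseAdjunction n D).leftAdjoint_preservesColimits
  ⟨fun _ => inferInstance⟩

theorem preservesFiniteProducts_op_comp {C D : Type 1} [Category.{0} C] [Category.{0} D]
    (G : C ⥤ D) [PreservesFiniteCoproducts G] (F : ProdFun.{w} D) :
    PreservesFiniteProducts (G.op ⋙ F.obj) :=
  have := preservesFiniteProducts_op G
  have : PreservesFiniteProducts F.obj := F.property
  comp_preservesFiniteProducts _ _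

/-- The collapse of a sphere of dimension at most `n` is an initial object. -/
noncomputable def isInitialCollapseSphere (i : ℕ) (hi : 0 < i) (hin : i ≤ n) :
    IsInitial ((collapse n D).obj (sphereObj i hi)) :=
  IsInitial.ofUniqueHom
    (fun Z => ((collapseAdjunction n D).homEquiv _ Z).symm
      (ObjectProperty.homMk (ho.map (constMap (sphere i) Z.obj.as))))
    (fun Z _ => ((collapseAdjunction n D).homEquiv _ Z).injective
      (ObjectProperty.hom_ext _ (sphere_hom_eq hin Z.property _ _)))

/-- `γ` sends a low sphere to an initial object, which is terminal in the opposite category, and `F`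
preserves the empty product. -/
theorem isConnected_restriction_collapse
    (hγ : ∀ F : ProdFun.{w} (WedgeCat n), PreservesFiniteProducts ((collapse n D).op ⋙ F.obj))
    (F : ProdFun.{w} (WedgeCat n)) : IsConnected.{w} n ((restriction (collapse n D) hγ).obj F) := by
  intro i hi hin
  have : PreservesFiniteProducts F.obj := F.property
  exact ⟨Types.isTerminalEquivUnique _
    (IsTerminal.isTerminalObj F.obj _ (isInitialCollapseSphere n D i hi hin).op)⟩

/-- The inclusion of a sphere in a space decomposed as a wedge of spheres. -/
noncomputable def SphereDecomposition.incl {X : WedgeCat 0} (S : SphereDecomposition 0 X.obj)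
    (i : S.ι) : sphereObj (S.dim i) (S.lt_dim i) ⟶ X :=
  ObjectProperty.homMk (sphereIncl S.dim i ≫ S.iso.inv)

/-- An object of `Π` is the coproduct of the spheres in a decomposition. -/
noncomputable def SphereDecomposition.isColimit {X : WedgeCat 0}
    (S : SphereDecomposition 0 X.obj) : IsColimit (Cofan.mk X S.incl) :=
  let c : IsColimit (Cofan.mk X.obj fun i => (S.incl i).hom) :=
    IsColimit.ofIsoColimit (hoWedgeIsColimit fun i => sphere (S.dim i))
      (Cofan.ext (c₂ := Cofan.mk X.obj fun i => (S.incl i).hom) S.iso.symm fun _ => rfl)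
  isColimitOfIsColimitCofanMkObj (IsWedgeOfSpheres 0).ι _ S.incl c

/-- The inclusion of the collapse of `X` in `X`. -/
noncomputable def collapseSection (X : WedgeCat 0) :
    (wedgeInclusion n).obj ((collapse n D).obj X) ⟶ X :=
  ObjectProperty.homMk (ho.map (highInclusion n (D X).dim) ≫ (D X).iso.inv)

theorem collapseSection_comp_collapseUnit (X : WedgeCat 0) :
    collapseSection n D X ≫ collapseUnit n D X = 𝟙 _ := by
  apply ObjectProperty.hom_ext
  change (ho.map (highInclusion n (D X).dim) ≫ (D X).iso.inv) ≫
    (D X).iso.hom ≫ ho.map (lowCollapse n (D X).dim) = 𝟙 (ho.obj (wedgeOfSpheres _))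
  simp only [Category.assoc, Iso.inv_hom_id_assoc, ho_highInclusion_comp_lowCollapse]

theorem incl_comp_collapseUnit_comp_collapseSection (X : WedgeCat 0) (i : (D X).ι)
    (hi : n < (D X).dim i) :
    (D X).incl i ≫ collapseUnit n D X ≫ collapseSection n D X = (D X).incl i := by
  apply ObjectProperty.hom_ext
  change (sphereIncl (D X).dim i ≫ (D X).iso.inv) ≫
    ((D X).iso.hom ≫ ho.map (lowCollapse n (D X).dim)) ≫
      ho.map (highInclusion n (D X).dim) ≫ (D X).iso.inv = sphereIncl (D X).dim i ≫ (D X).iso.inv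
  have := sphereIncl_lowCollapse_highInclusion n (D X).dim hi
  simp only [Category.assoc, Iso.inv_hom_id_assoc]
  simp only [← Category.assoc] at this ⊢
  rw [this]

/-- The inverse is induced by the inclusion `γ X ⟶ X`. One composite is the identity already in `Π`;
the other is checked on the factors of `A(X) = ∏ A(S^(d i))`, where high spheres are fixed by
collapse followed by inclusion and low spheres contribute one-point sets. -/
theorem isIso_map_collapseUnit (A : PiAlg.{w}) (hA : IsConnected n A) (X : WedgeCat 0) :
    IsIso (A.obj.map (collapseUnit n D X).op) := by
  have : PreservesFiniteProducts A.obj := A.property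
  have : Finite (D X).ι := (D X).finite
  have hlim := isLimitFanMkObjOfIsLimit A.obj _ _ (Cofan.IsColimit.op (D X).isColimit)
  refine ⟨A.obj.map (collapseSection n D X).op, ?_, ?_⟩
  · rw [← Functor.map_comp, ← op_comp, collapseSection_comp_collapseUnit, op_id,
      CategoryTheory.Functor.map_id]
  · refine Fan.IsLimit.hom_ext hlim _ _ fun i => ?_
    by_cases hi : n < (D X).dim i
    · change (A.obj.map (collapseSection n D X).op ≫ A.obj.map (collapseUnit n D X).op) ≫
        A.obj.map ((D X).incl i).op = 𝟙 _ ≫ A.obj.map ((D X).incl i).op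
      rw [← Functor.map_comp, ← Functor.map_comp, ← op_comp, ← op_comp,
        incl_comp_collapseUnit_comp_collapseSection n D X i hi, Category.id_comp]
    · obtain ⟨u⟩ := hA _ ((D X).lt_dim i) (not_lt.1 hi)
      exact ((Types.isTerminalEquivUnique _).symm u).hom_ext _ _

/-- Restricting along the inclusion undoes restricting along the collapse functor. -/
noncomputable def restrictionCollapseUnit (F : ProdFun.{w} (WedgeCat n)) :
    F.obj ≅ (wedgeInclusion n).op ⋙ (collapse n D).op ⋙ F.obj :=
  NatIso.ofComponents
    -- The counit is invertible since the right adjoint `I^n` is fully faithful.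
    (fun Z => F.obj.mapIso (asIso ((collapseAdjunction n D).counit.app Z.unop)).op)
    (fun f => by
      change F.obj.map f ≫ F.obj.map _ = F.obj.map _ ≫ F.obj.map _
      rw [← Functor.map_comp, ← Functor.map_comp]
      exact congrArg (fun k => F.obj.map k.op)
        ((collapseAdjunction n D).counit.naturality f.unop).symm)

/-- Restricting along the collapse functor undoes restricting along the inclusion, for
`n`-connected `Π`-algebras. -/
noncomputable def restrictionCollapseCounit (A : ConnPiAlg.{w} n) :
    (collapse n D).op ⋙ (wedgeInclusion n).op ⋙ A.obj.obj ≅ A.obj.obj :=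
  NatIso.ofComponents
    (fun X =>
      have : IsIso (A.obj.obj.map ((collapseAdjunction n D).unit.app X.unop).op) := by
        rw [collapseAdjunction_unit_app]
        exact isIso_map_collapseUnit n D A.obj A.property X.unop
      asIso (A.obj.obj.map ((collapseAdjunction n D).unit.app X.unop).op))
    (fun f => by
      change A.obj.obj.map _ ≫ A.obj.obj.map _ = A.obj.obj.map _ ≫ A.obj.obj.map f
      rw [← Functor.map_comp, ← Functor.map_comp]
      exact congrArg (fun k => A.obj.obj.map k.op)
        ((collapseAdjunction n D).unit.naturality f.unop).symm)

/-- The equivalence of categories given by restriction along the collapse functor and along the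
inclusion. -/
noncomputable def restrictionEquivalence
    (hγ : ∀ F : ProdFun.{w} (WedgeCat n), PreservesFiniteProducts ((collapse n D).op ⋙ F.obj))
    (hI : ∀ A : PiAlg.{w}, PreservesFiniteProducts ((wedgeInclusion n).op ⋙ A.obj)) :
    ProdFun.{w} (WedgeCat n) ≌ ConnPiAlg.{w} n :=
  -- No triangle identity is needed: `mk` adjusts the unit and leaves both functors untouched, so
  -- they are recovered by `rfl`.
  CategoryTheory.Equivalence.mk
    ((IsConnected.{w} n).lift (restriction (collapse n D) hγ)
      (isConnected_restriction_collapse n D hγ))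
    ((IsConnected.{w} n).ι ⋙ restriction (wedgeInclusion n) hI)
    (NatIso.ofComponents
      (fun F => ObjectProperty.isoMk _ (restrictionCollapseUnit n D F))
      (fun φ => by
        apply ObjectProperty.hom_ext
        ext Z : 2
        exact (φ.hom.naturality _).symm))
    (NatIso.ofComponents
      (fun A => ObjectProperty.isoMk _ (ObjectProperty.isoMk _ (restrictionCollapseCounit n D A)))
      (fun φ => by
        apply ObjectProperty.hom_ext
        apply ObjectProperty.hom_ext
        ext X : 2
        exact (φ.hom.hom.naturality _).symm))

end Restriction

end PiAlgebra

theorem proposition4p4 (n : ℕ) (D : PiAlgebra.DecompositionChoice) :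
    ∃ (map_id : ∀ X : PiAlgebra.WedgeCat 0,
        PiAlgebra.collapseMap n D (𝟙 X) = 𝟙 (PiAlgebra.collapseObj n D X))
      (map_comp : ∀ {X Y Z : PiAlgebra.WedgeCat 0} (f : X ⟶ Y) (g : Y ⟶ Z),
        PiAlgebra.collapseMap n D (f ≫ g) =
          PiAlgebra.collapseMap n D f ≫ PiAlgebra.collapseMap n D g)
      (hγ : ∀ F : PiAlgebra.ProdFun.{w} (PiAlgebra.WedgeCat n), PreservesFiniteProducts
        ((PiAlgebra.collapseFunctor n D map_id map_comp).op ⋙ F.obj))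
      (hI : ∀ A : PiAlgebra.PiAlg.{w}, PreservesFiniteProducts
        ((PiAlgebra.wedgeInclusion n).op ⋙ A.obj))
      (hconn : ∀ F : PiAlgebra.ProdFun.{w} (PiAlgebra.WedgeCat n), PiAlgebra.IsConnected.{w} n
        ((PiAlgebra.restriction (PiAlgebra.collapseFunctor n D map_id map_comp) hγ).obj F))
      (e : PiAlgebra.ProdFun.{w} (PiAlgebra.WedgeCat n) ≌ PiAlgebra.ConnPiAlg.{w} n),
      e.functor = (PiAlgebra.IsConnected.{w} n).lift
          (PiAlgebra.restriction (PiAlgebra.collapseFunctor n D map_id map_comp) hγ) hconn ∧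
      e.inverse = (PiAlgebra.IsConnected.{w} n).ι ⋙
          PiAlgebra.restriction (PiAlgebra.wedgeInclusion n) hI :=
  ⟨PiAlgebra.collapseMap_id n D, PiAlgebra.collapseMap_comp n D,
    PiAlgebra.preservesFiniteProducts_op_comp (PiAlgebra.collapse n D),
    PiAlgebra.preservesFiniteProducts_op_comp (PiAlgebra.wedgeInclusion n),
    PiAlgebra.isConnected_restriction_collapse n D _,
    PiAlgebra.restrictionEquivalence n D _ _, rfl, rfl⟩
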